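/- Let $N=\{1,\dots,n\}$ be a set of items and $\Gamma$ a finite set of states. A realization is an $a\in\Gamma^n$, and a partial realization is a $b\in(\Gamma\cup\{*\})^n$, where $b_i=*$ means that the state of item $i$ is unknown; $b'\succeq b$ means that $b'_i=b_i$ whenever $b_i\ne *$, and $b_{i\leftarrow\gamma}$ is $b$ with $b_i$ replaced by $\gamma$. For a function $f$ on partial realizations put $\Delta f(b,i,\gamma)=f(b_{i\leftarrow\gamma})-f(b)$. An instance $(g,Q,S,w,c)$ of Scenario Submodular Cover consists of an integer $Q>0$; a function $g\colon(\Gamma\cup\{*\})^n\to\mathbb{Z}_{\ge 0}$ with $g(a)=Q$ for all $a\in\Gamma^n$ that is monotone ($\Delta g(b,i,\gamma)\ge 0$ whenever $b_i=*$) and submodular ($\Delta g(b,i,\gamma)\ge\Delta g(b',i,\gamma)$ whenever $b'\succeq b$ and $b_i=b'_i=*$); a nonempty sample $S\subseteq\Gamma^n$; a positive integer weight $w(a)$ for each $a\in S$; and a cost $c_i>0$ for each item $i$. Let $W=\sum_{a\in S}w(a)$. The sample distribution gives probability $w(a)/W$ to each $a\in S$ and $0$ to all other realizations. A strategy is a decision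 tree that chooses items one at a time without repetition, where the state of an item is revealed when it is chosen, and later choices may depend on the states revealed. It is feasible if on every realization $a\in\Gamma^n$ (in $S$ or not) it stops at a partial realization $b$ with $g(b)=Q$. Its expected cost is the expectation of the sum of the costs of the chosen items under the sample distribution. Let $h_W(b)=W-\sum_{a\in S,\,a\succeq b}w(a)$ and $g_W(b)=QW-(Q-g(b))(W-h_W(b))$. Scenario Adaptive Greedy first runs Adaptive Greedy on $g_W$: starting from $b=(*,\dots,*)$, as long as $g_W(b)\neq QW$, it chooses an item $i$ with $b_i=*$ that maximizes $\frac{1}{c_i}\,\mathbb{E}[\Delta g_W(b,i,a_i)\mid a\succeq b]$, where $a$ is drawn from the sample distribution (ties are broken arbitrarily), and updates $b$ with the revealed state. After that it chooses remaining items in arbitrary order until $g(b)=Q$. Theorem. Scenario Adaptive Greedy achieves an $O(\log QW)$ approximation for Scenario Submodular Cover. That is, it can be run on every instance, it always yields a feasible strategy, and there is an absolute constant $C>0$ such that on every instance, whatever the arbitrary choices, the expected cost of the strategy it yields is at most $C\,(1+\log(QW))$ times the expected cost of any feasible strategy. -/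

import Mathlib

universe u

namespace ScenarioSC

/-- A realization assigns a state in `Γ` to each of the `n` items. -/
abbrev Realization (n : ℕ) (Γ : Type u) := Fin n → Γ

/-- A partial realization: `b i = none` means that the state of item `i` is unknown
(written `*` on paper), `b i = some γ` that item `i` has state `γ`. -/
abbrev PartialRealization (n : ℕ) (Γ : Type u) := Fin n → Option Γ

section Basics

variable {n : ℕ} {Γ : Type u}

/-- The partial realization in which nothing is known. -/
def emptyPartial : PartialRealization n Γ := fun _ => none

/-- A realization, regarded as a partial realization. -/
def Realization.toPartial (a : Realization n Γ) : PartialRealization n Γ := fun i => some (a i)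

/-- `b.set i γ` is `b` with the state of item `i` set to `γ`. -/
def PartialRealization.set (b : PartialRealization n Γ) (i : Fin n) (γ : Γ) :
    PartialRealization n Γ := Function.update b i (some γ)

/-- `Extends b' b` : the partial realization `b'` is an extension of `b`. -/
def Extends (b' b : PartialRealization n Γ) : Prop := ∀ i, b i ≠ none → b' i = b i

/-- The increase of the utility `f` when the state of item `i` is found to be `γ`. -/
def gain (f : PartialRealization n Γ → ℤ) (b : PartialRealization n Γ) (i : Fin n) (γ : Γ) : ℤ :=
  f (b.set i γ) - f b

/-- Monotonicity of a state-dependent utility function. -/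
def MonotoneUtility (f : PartialRealization n Γ → ℤ) : Prop :=
  ∀ (b : PartialRealization n Γ) (i : Fin n) (γ : Γ), b i = none → f b ≤ f (b.set i γ)

/-- The diminishing-returns property of a state-dependent utility function. -/
def SubmodularUtility (f : PartialRealization n Γ → ℤ) : Prop :=
  ∀ (b b' : PartialRealization n Γ), Extends b' b → b' ≠ b →
    ∀ (i : Fin n) (γ : Γ), b i = none → b' i = none → gain f b' i γ ≤ gain f b i γ

/-- `f` takes the value `Q` on every (full) realization. -/
def HasGoalValue (f : PartialRealization n Γ → ℤ) (Q : ℤ) : Prop :=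
  ∀ a : Realization n Γ, f (Realization.toPartial a) = Q

/-- The standard OR construction for utilities `f₁`, `f₂` and values `Q₁`, `Q₂`. -/
def orConstruction (f₁ f₂ : PartialRealization n Γ → ℤ) (Q₁ Q₂ : ℤ) :
    PartialRealization n Γ → ℤ :=
  fun b => Q₁ * Q₂ - (Q₁ - f₁ b) * (Q₂ - f₂ b)

end Basics

/-! ### Probabilities on realizations, given by their mass functions -/

section Probability

variable {n : ℕ} {Γ : Type u} [Fintype Γ]

open scoped Classical in
/-- The conditional probability of the realization `a` given that the realization extends `b`,
when realizations have mass function `p`. -/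
noncomputable def condProb (p : Realization n Γ → ℝ) (b : PartialRealization n Γ)
    (a : Realization n Γ) : ℝ :=
  if Extends (Realization.toPartial a) b then
    p a / ∑ a' : Realization n Γ with Extends (Realization.toPartial a') b, p a'
  else 0

/-- The conditional expectation, given `b`, of the increase of the utility `f` when the state of
item `i` is revealed. -/
noncomputable def expectedGain (p : Realization n Γ → ℝ) (f : PartialRealization n Γ → ℤ)
    (b : PartialRealization n Γ) (i : Fin n) : ℝ :=
  ∑ a : Realization n Γ, (gain f b i (a i) : ℝ) * condProb p b a

end Probability

/-! ### Adaptive strategies -/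

/-- A strategy, as a decision tree: at `node i child` item `i` is chosen, and if its state turns
out to be `γ` then the strategy goes on with `child γ`; at a `leaf` it stops. -/
inductive DecisionTree (n : ℕ) (Γ : Type u) : Type u
  | leaf : DecisionTree n Γ
  | node (i : Fin n) (child : Γ → DecisionTree n Γ) : DecisionTree n Γ

namespace DecisionTree

variable {n : ℕ} {Γ : Type u}

/-- What is known after running the tree on the realization `a`, starting from the knowledge
`b`. -/
def finalState : DecisionTree n Γ → Realization n Γ → PartialRealization n Γ →
    PartialRealization n Γ
  | leaf, _, b => b
  | node i child, a, b => (child (a i)).finalState a (b.set i (a i))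

/-- The sum of the costs of the items that the tree chooses on the realization `a`. -/
def pathCost (c : Fin n → ℝ) : DecisionTree n Γ → Realization n Γ → ℝ
  | leaf, _ => 0
  | node i child, a => c i + (child (a i)).pathCost c a

/-- No item of `used` occurs in the tree, and no item occurs twice on a path from the root. -/
def NoRepeat : DecisionTree n Γ → Finset (Fin n) → Prop
  | leaf, _ => True
  | node i child, used => i ∉ used ∧ ∀ γ, (child γ).NoRepeat (insert i used)

/-- The tree that first runs the given tree, starting from the knowledge `b`, and at each leaf,
if the knowledge there is `b'`, goes on with the tree `next b'`. -/
def andThen (next : PartialRealization n Γ → DecisionTree n Γ) :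
    DecisionTree n Γ → PartialRealization n Γ → DecisionTree n Γ
  | leaf, b => next b
  | node i child, b => node i fun γ => (child γ).andThen next (b.set i γ)

/-- The expected cost of the tree when realizations have mass function `p`. -/
noncomputable def expectedCost [Fintype Γ] (p : Realization n Γ → ℝ) (c : Fin n → ℝ)
    (t : DecisionTree n Γ) : ℝ :=
  ∑ a : Realization n Γ, p a * t.pathCost c a

end DecisionTree

/-! ### The Adaptive Greedy algorithm -/

section Greedy

variable {n : ℕ} {Γ : Type u} [Fintype Γ]

/-- When `b` is known, item `i` is an admissible greedy choice: its state is unknown, and among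
all such items it maximizes the expected gain per unit cost. -/
def IsGreedyChoice (p : Realization n Γ → ℝ) (f : PartialRealization n Γ → ℤ) (c : Fin n → ℝ)
    (b : PartialRealization n Γ) (i : Fin n) : Prop :=
  b i = none ∧
    ∀ j, b j = none → expectedGain p f b j / c j ≤ expectedGain p f b i / c i

/-- `IsAdaptiveGreedy p f goal c b t` : starting from the knowledge `b`, the tree `t` is a possible
output of Adaptive Greedy for the utility `f` with goal value `goal` and item costs `c`, with respect to
the mass function `p`; that is, it makes greedy choices (breaking ties in any way, possibly differently at
different nodes) as long as the utility differs from the goal value, and then stops. -/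
inductive IsAdaptiveGreedy (p : Realization n Γ → ℝ) (f : PartialRealization n Γ → ℤ) (goal : ℤ)
    (c : Fin n → ℝ) : PartialRealization n Γ → DecisionTree n Γ → Prop
  | done {b : PartialRealization n Γ} (h : f b = goal) :
      IsAdaptiveGreedy p f goal c b DecisionTree.leaf
  | choose {b : PartialRealization n Γ} {i : Fin n} {child : Γ → DecisionTree n Γ}
      (h : f b ≠ goal) (hi : IsGreedyChoice p f c b i)
      (hchild : ∀ γ, IsAdaptiveGreedy p f goal c (b.set i γ) (child γ)) :
      IsAdaptiveGreedy p f goal c b (DecisionTree.node i child)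

end Greedy

/-- `IsCompletion f goal b t` : starting from the knowledge `b`, the tree `t` chooses remaining
items, in any order, as long as the utility `f` differs from `goal`, and then stops. -/
inductive IsCompletion {n : ℕ} {Γ : Type u} (f : PartialRealization n Γ → ℤ) (goal : ℤ) :
    PartialRealization n Γ → DecisionTree n Γ → Prop
  | done {b : PartialRealization n Γ} (h : f b = goal) : IsCompletion f goal b DecisionTree.leaf
  | choose {b : PartialRealization n Γ} {i : Fin n} {child : Γ → DecisionTree n Γ}
      (h : f b ≠ goal) (hi : b i = none)
      (hchild : ∀ γ, IsCompletion f goal (b.set i γ) (child γ)) :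
      IsCompletion f goal b (DecisionTree.node i child)

/-! ### Scenario Submodular Cover -/

/-- An instance of Scenario Submodular Cover with `n` items and state set `Γ`. Only the values of
`weight` on `sample` matter. -/
structure Instance (n : ℕ) (Γ : Type u) where
  utility : PartialRealization n Γ → ℕ
  goal : ℕ
  sample : Finset (Realization n Γ)
  weight : Realization n Γ → ℕ
  cost : Fin n → ℝ
  utility_monotone : MonotoneUtility fun b => (utility b : ℤ)
  utility_submodular : SubmodularUtility fun b => (utility b : ℤ)
  utility_goal : HasGoalValue (fun b => (utility b : ℤ)) (goal : ℤ)
  goal_pos : 0 < goal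
  sample_nonempty : sample.Nonempty
  weight_pos : ∀ a ∈ sample, 0 < weight a
  cost_pos : ∀ i, 0 < cost i

namespace Instance

variable {n : ℕ} {Γ : Type u} (I : Instance n Γ)

/-- The utility function of the instance, with values regarded as integers. -/
def g (b : PartialRealization n Γ) : ℤ := (I.utility b : ℤ)

/-- The total weight of the sample. -/
def W : ℕ := ∑ a ∈ I.sample, I.weight a

open scoped Classical in
/-- The mass function of the sample distribution. -/
noncomputable def sampleProb (a : Realization n Γ) : ℝ :=
  if a ∈ I.sample then (I.weight a : ℝ) / (I.W : ℝ) else 0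

open scoped Classical in
/-- The weight eliminated by `b`: the total weight of the sample, minus the weight of the sample
realizations that extend `b`. -/
noncomputable def hW (b : PartialRealization n Γ) : ℤ :=
  (I.W : ℤ) - ∑ a ∈ I.sample with Extends (Realization.toPartial a) b, (I.weight a : ℤ)

/-- The OR combination of the utility function with `hW`. -/
noncomputable def gW : PartialRealization n Γ → ℤ :=
  orConstruction I.g I.hW (I.goal : ℤ) (I.W : ℤ)

/-- `t` is a feasible strategy: it selects items without repetition, and on every realization
(in the sample or not) the goal value is reached when it stops. -/
def IsFeasible (t : DecisionTree n Γ) : Prop :=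
  t.NoRepeat ∅ ∧ ∀ a : Realization n Γ, I.g (t.finalState a emptyPartial) = (I.goal : ℤ)

/-- The expected cost of a strategy with respect to the sample distribution. -/
noncomputable def expectedCost [Fintype Γ] (t : DecisionTree n Γ) : ℝ :=
  t.expectedCost I.sampleProb I.cost

/-- `t` is a possible output of Scenario Adaptive Greedy: run Adaptive Greedy on `gW` with goal
value `Q * W` with respect to the sample distribution; then, where the original utility has not
reached `Q` yet, choose remaining items in any order until it has. -/
def IsScenarioAdaptiveGreedy [Fintype Γ] (t : DecisionTree n Γ) : Prop :=
  ∃ (t₀ : DecisionTree n Γ) (next : PartialRealization n Γ → DecisionTree n Γ),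
    IsAdaptiveGreedy I.sampleProb I.gW ((I.goal : ℤ) * (I.W : ℤ)) I.cost emptyPartial t₀ ∧
    (∀ b, IsCompletion I.g (I.goal : ℤ) b (next b)) ∧
    t = t₀.andThen next emptyPartial

end Instance

end ScenarioSC

namespace ScenarioSC

variable {n : ℕ} {Γ : Type u}

/-! ### Extensions of partial realizations -/

/-! Two facts combine. First, `gW` is adaptive submodular for the sample distribution
(`adaptiveSubmodular_gW`). Its distance to the goal at `b` is W·(Q − g(b))·m(b), with m the
probability of extending `b`, and its expected gain is a sum of products of nonnegative factors that
shrink as knowledge grows. Second, Adaptive Greedy is a logarithmic approximation for any monotone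
adaptive submodular cover (`IsAdaptiveGreedy.expectedCost_le`). Scale the cost of a competing
strategy by L. Greedy cost incurred below the scaled cost is paid by the competitor. Otherwise the
competitor has already finished within a small budget; adaptive submodularity bounds the probability
of this by the greedy relative progress, which telescopes to H = 1 + log(QW). With L = 2H half of
the greedy cost is absorbed, giving the factor 4H. Finally, when the greedy phase stops on a sample
realization, some sample weight is still consistent, so g has reached Q. The completion phase
therefore costs something only on realizations of probability 0. Conversely, any feasible strategy
also reaches the goal for `gW`, so it is a legitimate competitor. -/

lemma Extends.refl (b : PartialRealization n Γ) : Extends b b := fun _ _ => rfl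

lemma Extends.trans {b₁ b₂ b₃ : PartialRealization n Γ} (h : Extends b₁ b₂) (h' : Extends b₂ b₃) :
    Extends b₁ b₃ := fun i hi => by
  rw [h i (by rw [h' i hi]; exact hi), h' i hi]

lemma extends_emptyPartial (b : PartialRealization n Γ) : Extends b emptyPartial :=
  fun _ hi => absurd rfl hi

lemma extends_set {b : PartialRealization n Γ} {i : Fin n} (hi : b i = none) (γ : Γ) :
    Extends (b.set i γ) b := fun j hj => by
  have : j ≠ i := by rintro rfl; exact hj hi
  simp [PartialRealization.set, this]

lemma Extends.set {b b' : PartialRealization n Γ} (h : Extends b' b) (i : Fin n) (γ : Γ) :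
    Extends (b'.set i γ) (b.set i γ) := fun j hj => by
  by_cases hji : j = i
  · subst hji; simp [PartialRealization.set]
  · simp only [PartialRealization.set, Function.update_of_ne hji] at hj ⊢
    exact h j hj

lemma toPartial_extends_set_iff {b : PartialRealization n Γ} {i : Fin n} (hi : b i = none)
    (γ : Γ) (a : Realization n Γ) :
    Extends (Realization.toPartial a) (b.set i γ) ↔
      Extends (Realization.toPartial a) b ∧ a i = γ := by
  constructor
  · intro h
    refine ⟨h.trans (extends_set hi γ), ?_⟩
    have := h i (by simp [PartialRealization.set])
    simpa [PartialRealization.set, Realization.toPartial] using this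
  · rintro ⟨h, rfl⟩ j hj
    by_cases hji : j = i
    · subst hji; simp [PartialRealization.set, Realization.toPartial]
    · simp only [PartialRealization.set, Function.update_of_ne hji] at hj ⊢
      exact h j hj

lemma set_eq_self {b : PartialRealization n Γ} {i : Fin n} {γ : Γ} (h : b i = some γ) :
    b.set i γ = b := by
  rw [PartialRealization.set, ← h, Function.update_eq_self]

lemma Extends.apply_eq {b : PartialRealization n Γ} {i : Fin n} {γ : Γ} {a : Realization n Γ}
    (h : Extends (Realization.toPartial a) b) (hb : b i = some γ) : a i = γ := by
  have := h i (by simp [hb])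
  simpa [Realization.toPartial, hb] using this

/-- The items whose state is unknown. -/
def unknown (b : PartialRealization n Γ) : Finset (Fin n) :=
  Finset.univ.filter fun i => (b i).isNone

lemma card_unknown_set_lt {b : PartialRealization n Γ} {i : Fin n} (hi : b i = none) (γ : Γ) :
    (unknown (b.set i γ)).card < (unknown b).card := by
  apply Finset.card_lt_card
  rw [Finset.ssubset_iff_of_subset]
  · exact ⟨i, by simp [unknown, hi], by simp [unknown, PartialRealization.set]⟩
  · intro j hj
    by_cases hji : j = i
    · subst hji; simp [unknown, hi]
    · simpa [unknown, PartialRealization.set, hji] using hj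

lemma exists_toPartial_eq {b : PartialRealization n Γ} (h : ∀ i, b i ≠ none) :
    ∃ a : Realization n Γ, Realization.toPartial a = b := by
  choose a ha using fun i => Option.ne_none_iff_exists'.mp (h i)
  exact ⟨a, funext fun i => (ha i).symm⟩

/-- Reveal one at a time the items known in `b'` but not in `b`; the number of unknown items of `b`
drops at each step. -/
lemma MonotoneUtility.le_of_extends {f : PartialRealization n Γ → ℤ} (hf : MonotoneUtility f)
    {b b' : PartialRealization n Γ} (h : Extends b' b) : f b ≤ f b' := by
  induction hk : (unknown b).card using Nat.strong_induction_on generalizing b with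
  | _ k ih =>
    by_cases hb : ∃ i, b i = none ∧ b' i ≠ none
    · obtain ⟨i, hi, hi'⟩ := hb
      obtain ⟨γ, hγ⟩ := Option.ne_none_iff_exists'.mp hi'
      refine (hf b i γ hi).trans (ih _ (hk ▸ card_unknown_set_lt hi γ) ?_ rfl)
      have := h.set i γ
      rwa [set_eq_self hγ] at this
    · push Not at hb
      have : b' = b := funext fun i => by
        by_cases hi : b i = none
        · rw [hb i hi, hi]
        · exact h i hi
      rw [this]

/-! ### Running decision trees -/

namespace DecisionTree

/-- Lets a strategy designed for the empty knowledge be run from any `b`, where it may choose items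
that are already known. -/
lemma finalState_extends_finalState (t : DecisionTree n Γ) (a : Realization n Γ)
    {b b' : PartialRealization n Γ} (h : Extends b' b) :
    Extends (t.finalState a b') (t.finalState a b) := by
  induction t generalizing b b' with
  | leaf => exact h
  | node i child ih => exact ih (a i) (h.set i (a i))

lemma pathCost_nonneg {c : Fin n → ℝ} (hc : ∀ i, 0 < c i) (t : DecisionTree n Γ)
    (a : Realization n Γ) : 0 ≤ t.pathCost c a := by
  induction t with
  | leaf => exact le_rfl
  | node i child ih => exact add_nonneg (hc i).le (ih (a i))

lemma finalState_andThen (t : DecisionTree n Γ) (next : PartialRealization n Γ → DecisionTree n Γ)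
    (a : Realization n Γ) (b : PartialRealization n Γ) :
    (t.andThen next b).finalState a b =
      (next (t.finalState a b)).finalState a (t.finalState a b) := by
  induction t generalizing b with
  | leaf => rfl
  | node i child ih => exact ih (a i) (b.set i (a i))

end DecisionTree

/-! ### Sums over the realizations that extend a partial realization -/

section PartialExpectation

variable [Fintype Γ]

open scoped Classical in
/-- The expectation of `F` restricted to the event that the realization extends `b`, when
realizations have mass function `p`. -/
noncomputable def partialExp (p : Realization n Γ → ℝ) (b : PartialRealization n Γ)
    (F : Realization n Γ → ℝ) : ℝ :=
  ∑ a : Realization n Γ with Extends (Realization.toPartial a) b, p a * F a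

/-- The probability that the realization extends `b`. -/
noncomputable def mass (p : Realization n Γ → ℝ) (b : PartialRealization n Γ) : ℝ :=
  partialExp p b fun _ => 1

variable {p : Realization n Γ → ℝ}

lemma partialExp_congr {b : PartialRealization n Γ} {F G : Realization n Γ → ℝ}
    (h : ∀ a, Extends (Realization.toPartial a) b → F a = G a) :
    partialExp p b F = partialExp p b G := by
  classical
  refine Finset.sum_congr rfl fun a ha => ?_
  rw [h a (Finset.mem_filter.mp ha).2]

lemma partialExp_mono (hp : ∀ a, 0 ≤ p a) {b : PartialRealization n Γ}
    {F G : Realization n Γ → ℝ} (h : ∀ a, Extends (Realization.toPartial a) b → F a ≤ G a) :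
    partialExp p b F ≤ partialExp p b G := by
  classical
  exact Finset.sum_le_sum fun a ha =>
    mul_le_mul_of_nonneg_left (h a (Finset.mem_filter.mp ha).2) (hp a)

lemma partialExp_add (b : PartialRealization n Γ) (F G : Realization n Γ → ℝ) :
    partialExp p b (fun a => F a + G a) = partialExp p b F + partialExp p b G := by
  simp only [partialExp, mul_add, Finset.sum_add_distrib]

lemma partialExp_const_mul (b : PartialRealization n Γ) (r : ℝ) (F : Realization n Γ → ℝ) :
    partialExp p b (fun a => r * F a) = r * partialExp p b F := by
  simp only [partialExp, Finset.mul_sum]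
  exact Finset.sum_congr rfl fun a _ => by ring

lemma partialExp_const (b : PartialRealization n Γ) (r : ℝ) :
    partialExp p b (fun _ => r) = r * mass p b := by
  rw [mass, ← partialExp_const_mul]; simp

lemma partialExp_emptyPartial (F : Realization n Γ → ℝ) :
    partialExp p emptyPartial F = ∑ a, p a * F a := by
  classical
  simp [partialExp, extends_emptyPartial]

/-- The states of an unknown item partition the event. As `partialExp` is not normalised, branches
add up without conditional weights, which is what the inductions on trees use. -/
lemma partialExp_eq_sum_set {b : PartialRealization n Γ} {i : Fin n} (hi : b i = none)
    (F : Realization n Γ → ℝ) :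
    partialExp p b F = ∑ γ, partialExp p (b.set i γ) F := by
  classical
  simp only [partialExp, toPartial_extends_set_iff hi]
  rw [← Finset.sum_fiberwise _ (fun a => a i)]
  simp only [Finset.filter_filter]

lemma partialExp_apply_eq_sum {b : PartialRealization n Γ} {i : Fin n} (hi : b i = none)
    (F : Γ → ℝ) :
    partialExp p b (fun a => F (a i)) = ∑ γ, F γ * mass p (b.set i γ) := by
  rw [partialExp_eq_sum_set hi]
  refine Finset.sum_congr rfl fun γ _ => ?_
  rw [← partialExp_const]
  exact partialExp_congr fun a ha => by rw [((toPartial_extends_set_iff hi γ a).mp ha).2]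

lemma mass_eq_sum_set {b : PartialRealization n Γ} {i : Fin n} (hi : b i = none) :
    mass p b = ∑ γ, mass p (b.set i γ) :=
  partialExp_eq_sum_set hi _

lemma mass_nonneg (hp : ∀ a, 0 ≤ p a) (b : PartialRealization n Γ) : 0 ≤ mass p b := by
  classical
  exact Finset.sum_nonneg fun a _ => by simpa using hp a

lemma mass_anti (hp : ∀ a, 0 ≤ p a) {b b' : PartialRealization n Γ} (h : Extends b' b) :
    mass p b' ≤ mass p b := by
  classical
  refine Finset.sum_le_sum_of_subset_of_nonneg ?_ fun a _ _ => by simpa using hp a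
  intro a ha
  simp only [Finset.mem_filter, Finset.mem_univ, true_and] at ha ⊢
  exact ha.trans h

lemma le_mass (hp : ∀ a, 0 ≤ p a) {b : PartialRealization n Γ} {a : Realization n Γ}
    (h : Extends (Realization.toPartial a) b) : p a ≤ mass p b := by
  classical
  have := Finset.single_le_sum (f := fun a => p a * 1)
    (s := Finset.univ.filter fun a : Realization n Γ => Extends (Realization.toPartial a) b)
    (fun a _ => by simpa using hp a) (Finset.mem_filter.mpr ⟨Finset.mem_univ a, h⟩)
  simpa [mass, partialExp] using this

lemma partialExp_eq_zero_of_mass (hp : ∀ a, 0 ≤ p a) {b : PartialRealization n Γ}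
    (h : mass p b = 0) (F : Realization n Γ → ℝ) : partialExp p b F = 0 := by
  classical
  refine Finset.sum_eq_zero fun a ha => ?_
  have h1 := le_mass hp (Finset.mem_filter.mp ha).2
  rw [le_antisymm (h1.trans h.le) (hp a), zero_mul]

/-- On an event of mass 0 both sides are 0, by the convention for division by 0. -/
lemma expectedGain_eq_div (f : PartialRealization n Γ → ℤ) (b : PartialRealization n Γ)
    (i : Fin n) :
    expectedGain p f b i = partialExp p b (fun a => (gain f b i (a i) : ℝ)) / mass p b := by
  classical
  rw [expectedGain, partialExp, Finset.sum_div, Finset.sum_filter]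
  refine Finset.sum_congr rfl fun a _ => ?_
  simp only [condProb, mass, partialExp, mul_one]
  split_ifs
  · ring
  · simp

lemma mass_mul_expectedGain (f : PartialRealization n Γ → ℤ) {b : PartialRealization n Γ}
    (h : 0 < mass p b) (i : Fin n) :
    partialExp p b (fun a => (gain f b i (a i) : ℝ)) = expectedGain p f b i * mass p b := by
  rw [expectedGain_eq_div, div_mul_cancel₀ _ h.ne']

end PartialExpectation

/-! ### The approximation guarantee of Adaptive Greedy -/

section GreedyBound

variable [Fintype Γ]

/-- Adaptive submodularity: conditioning on more information does not increase the expected gain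
of an item. -/
def AdaptiveSubmodular (p : Realization n Γ → ℝ) (f : PartialRealization n Γ → ℤ) : Prop :=
  ∀ (b b' : PartialRealization n Γ) (i : Fin n), Extends b' b → b' i = none → 0 < mass p b' →
    expectedGain p f b' i ≤ expectedGain p f b i

variable {p : Realization n Γ → ℝ} {f : PartialRealization n Γ → ℤ} {c : Fin n → ℝ}

open scoped Classical in
/-- If, given `b`, every item has expected gain per unit cost at most `r`, then a strategy stopped
once it would exceed the budget `τ` has expected gain at most `τ * r`. -/
lemma partialExp_gain_within_budget_le (hp : ∀ a, 0 ≤ p a) (hc : ∀ i, 0 < c i)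
    (hf : MonotoneUtility f) (hsub : AdaptiveSubmodular p f) {b : PartialRealization n Γ} {r : ℝ}
    (hr : 0 ≤ r) (hrate : ∀ i, b i = none → expectedGain p f b i ≤ r * c i)
    (t : DecisionTree n Γ) {b' : PartialRealization n Γ} (hb' : Extends b' b) {τ : ℝ}
    (hτ : 0 ≤ τ) :
    partialExp p b' (fun a => if t.pathCost c a ≤ τ
      then (f (t.finalState a b') : ℝ) - f b' else 0) ≤ τ * r * mass p b' := by
  have hrhs : ∀ {x : ℝ} {d : PartialRealization n Γ}, 0 ≤ x → 0 ≤ x * r * mass p d :=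
    fun hx => mul_nonneg (mul_nonneg hx hr) (mass_nonneg hp _)
  induction t generalizing b' τ with
  | leaf =>
    refine le_trans (le_of_eq ?_) (hrhs hτ)
    rw [partialExp_congr (G := fun _ => (0 : ℝ)), partialExp_const, zero_mul]
    intro a _
    simp [DecisionTree.finalState]
  | node i child ih =>
    by_cases hci : c i ≤ τ
    swap
    -- The first item alone exceeds the budget, so the integrand vanishes.
    · refine le_trans (le_of_eq ?_) (hrhs hτ)
      rw [partialExp_congr (G := fun _ => (0 : ℝ)), partialExp_const, zero_mul]
      intro a _
      rw [if_neg]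
      have := (child (a i)).pathCost_nonneg hc a
      simp only [DecisionTree.pathCost]
      linarith
    have hτ' : 0 ≤ τ - c i := by linarith
    rcases hi : b' i with _ | γ
    · rcases (mass_nonneg hp b').eq_or_lt with hm | hm
      · rw [partialExp_eq_zero_of_mass hp hm.symm]; exact hrhs hτ
      have hbi : b i = none := by
        by_contra h
        exact h (by rw [← hb' i h, hi])
      -- By adaptive submodularity the rate `r` assumed at `b` still bounds the expected gain at the
      -- later `b'`.
      have h1 : partialExp p b' (fun a => (gain f b' i (a i) : ℝ)) ≤ r * c i * mass p b' := by
        rw [mass_mul_expectedGain f hm]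
        exact mul_le_mul_of_nonneg_right ((hsub b b' i hb' hi hm).trans (hrate i hbi)) hm.le
      have h2 : partialExp p b' (fun a => if (child (a i)).pathCost c a ≤ τ - c i
          then (f ((child (a i)).finalState a (b'.set i (a i))) : ℝ) - f (b'.set i (a i)) else 0)
          ≤ (τ - c i) * r * mass p b' := by
        rw [partialExp_eq_sum_set hi, mass_eq_sum_set hi, Finset.mul_sum]
        refine Finset.sum_le_sum fun γ _ => ?_
        refine le_trans (le_of_eq ?_) (ih γ ((extends_set hi γ).trans hb') hτ')
        refine partialExp_congr fun a ha => ?_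
        rw [((toPartial_extends_set_iff hi γ a).mp ha).2]
      refine (partialExp_mono hp (G := fun a => (gain f b' i (a i) : ℝ) +
        (if (child (a i)).pathCost c a ≤ τ - c i
          then (f ((child (a i)).finalState a (b'.set i (a i))) : ℝ) - f (b'.set i (a i))
          else 0)) ?_).trans ?_
      · intro a _
        have hg : (0 : ℝ) ≤ gain f b' i (a i) := by
          exact_mod_cast sub_nonneg.mpr (hf b' i (a i) hi)
        have hiff : (DecisionTree.node i child).pathCost c a ≤ τ ↔
            (child (a i)).pathCost c a ≤ τ - c i := by
          simp only [DecisionTree.pathCost]; constructor <;> intro h <;> linarith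
        simp only [hiff, DecisionTree.finalState]
        split_ifs
        · simp only [gain]; push_cast; linarith
        · simpa using hg
      · rw [partialExp_add]; linarith
    -- An item already known uses up budget but leaves the knowledge unchanged.
    · refine le_trans (le_of_eq (partialExp_congr fun a ha => ?_))
        ((ih γ hb' hτ').trans ?_)
      · have hiff : (DecisionTree.node i child).pathCost c a ≤ τ ↔
            (child γ).pathCost c a ≤ τ - c i := by
          simp only [DecisionTree.pathCost, ha.apply_eq hi]
          constructor <;> intro h <;> linarith
        simp only [hiff, DecisionTree.finalState, ha.apply_eq hi, set_eq_self hi]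
      · have := mul_nonneg (mul_nonneg (hc i).le hr) (mass_nonneg hp b')
        linarith

/-- An upper bound for the sum of the relative decreases of the distance `x` to the goal, from a
given distance on. -/
noncomputable def residualBound (x : ℤ) : ℝ := if x = 0 then 0 else 1 + Real.log x

/-- For y > 0 this is 1 − y/x ≤ log (x/y). The summand 1 in `residualBound` pays for the final jump
to 0, where the logarithm is unavailable; integrality gives x ≥ 1 and so log x ≥ 0. -/
lemma div_le_residualBound_sub {x y : ℤ} (hx : 0 < x) (hy : 0 ≤ y) :
    ((x : ℝ) - y) / x ≤ residualBound x - residualBound y := by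
  have hx' : (0 : ℝ) < x := by exact_mod_cast hx
  have hx1 : (1 : ℝ) ≤ x := by exact_mod_cast hx
  unfold residualBound
  rw [if_neg hx.ne']
  split_ifs with h
  · subst h
    have := Real.log_nonneg hx1
    simp only [Int.cast_zero, sub_zero, div_self hx'.ne']
    linarith
  · have hy' : (0 : ℝ) < y := by exact_mod_cast (by omega : 0 < y)
    have h1 := Real.log_le_sub_one_of_pos (div_pos hy' hx')
    rw [Real.log_div hy'.ne' hx'.ne'] at h1
    rw [sub_div, div_self hx'.ne']
    linarith

lemma residualBound_le_of_le {x y : ℤ} (hx : 0 ≤ x) (hy : 0 < y) (h : x ≤ y) :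
    residualBound x ≤ 1 + Real.log y := by
  have hy1 : (1 : ℝ) ≤ y := by exact_mod_cast hy
  unfold residualBound
  split_ifs with h0
  · linarith [Real.log_nonneg hy1]
  · have hx' : (0 : ℝ) < x := by exact_mod_cast (by omega : 0 < x)
    have : Real.log x ≤ Real.log y := Real.log_le_log hx' (by exact_mod_cast h)
    linarith

/-- Here `T` is the cost spent before reaching `b`. The difference of minima is the part of the
remaining greedy cost lying below `L` times the cost of `t'`. The last term pays for the rest: an
item started at `T` is charged (T + c i)/L times the drop of `residualBound`, and summation by parts
turns these charges into a boundary term plus cost times `residualBound` at most `H`. -/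
lemma IsAdaptiveGreedy.partialExp_pathCost_le (hp : ∀ a, 0 ≤ p a) (hc : ∀ i, 0 < c i)
    (hf : MonotoneUtility f) (hsub : AdaptiveSubmodular p f) {goal : ℤ}
    (hgoal : ∀ b, f b ≤ goal) {t' : DecisionTree n Γ}
    (ht' : ∀ a b, f (t'.finalState a b) = goal) {H : ℝ}
    (hH : ∀ b, residualBound (goal - f b) ≤ H) {L : ℝ} (hL : 0 < L)
    {b : PartialRealization n Γ} {t : DecisionTree n Γ} (ht : IsAdaptiveGreedy p f goal c b t)
    {T : ℝ} (hT : 0 ≤ T) :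
    partialExp p b (t.pathCost c) ≤
      partialExp p b (fun a => min (T + t.pathCost c a) (L * t'.pathCost c a) -
        min T (L * t'.pathCost c a)) +
      (T * residualBound (goal - f b) * mass p b + H * partialExp p b (t.pathCost c)) / L := by
  classical
  induction ht generalizing T with
  | @done b h =>
    have h1 : partialExp p b (DecisionTree.leaf.pathCost c) = 0 := by
      rw [show (DecisionTree.leaf : DecisionTree n Γ).pathCost c = fun _ => 0 from rfl,
        partialExp_const, zero_mul]
    have h2 : partialExp p b (fun a => min (T + DecisionTree.leaf.pathCost c a)
        (L * t'.pathCost c a) - min T (L * t'.pathCost c a)) = 0 := by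
      rw [partialExp_congr (G := fun _ => (0 : ℝ)), partialExp_const, zero_mul]
      intro a _
      simp [DecisionTree.pathCost]
    rw [h1, h2, h, sub_self, residualBound, if_pos rfl]
    simp
  | @choose b i child h hi hchild ih =>
    have hci := hc i
    set O := t'.pathCost c with hO
    set x := goal - f b with hxdef
    have hx : 0 < x := by have := hgoal b; omega
    have hx' : (0 : ℝ) < x := by exact_mod_cast hx
    have hTc : 0 ≤ T + c i := by linarith
    have hm0 := mass_nonneg hp b
    -- the expected cost and the truncated cost split off the cost of the first item
    have hcost : partialExp p b ((DecisionTree.node i child).pathCost c) =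
        c i * mass p b + ∑ γ, partialExp p (b.set i γ) ((child γ).pathCost c) := by
      have : (DecisionTree.node i child).pathCost c =
        fun a : Realization n Γ => c i + (child (a i)).pathCost c a := rfl
      rw [this, partialExp_add, partialExp_const, partialExp_eq_sum_set hi.1]
      congr 1
      refine Finset.sum_congr rfl fun γ _ => partialExp_congr fun a ha => ?_
      rw [((toPartial_extends_set_iff hi.1 γ a).mp ha).2]
    have htrunc : partialExp p b (fun a => min (T + (DecisionTree.node i child).pathCost c a)
          (L * O a) - min T (L * O a)) =
        partialExp p b (fun a => min (T + c i) (L * O a) - min T (L * O a)) +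
        ∑ γ, partialExp p (b.set i γ) (fun a => min (T + c i + (child γ).pathCost c a) (L * O a) -
          min (T + c i) (L * O a)) := by
      have : ∑ γ, partialExp p (b.set i γ) (fun a => min (T + c i + (child γ).pathCost c a)
          (L * O a) - min (T + c i) (L * O a)) = partialExp p b (fun a =>
            min (T + c i + (child (a i)).pathCost c a) (L * O a) - min (T + c i) (L * O a)) := by
        rw [partialExp_eq_sum_set hi.1]
        refine Finset.sum_congr rfl fun γ _ => partialExp_congr fun a ha => ?_
        rw [((toPartial_extends_set_iff hi.1 γ a).mp ha).2]
      rw [this, ← partialExp_add]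
      refine partialExp_congr fun a _ => ?_
      simp only [DecisionTree.pathCost, ← add_assoc]
      ring
    -- the decrease of the residual bound pays for the first item
    have hres : partialExp p b (fun a => (gain f b i (a i) : ℝ)) / x ≤
        residualBound x * mass p b -
          ∑ γ, residualBound (goal - f (b.set i γ)) * mass p (b.set i γ) := by
      rw [partialExp_apply_eq_sum hi.1 (fun γ => (gain f b i γ : ℝ)), mass_eq_sum_set hi.1,
        Finset.sum_div, Finset.mul_sum, ← Finset.sum_sub_distrib]
      refine Finset.sum_le_sum fun γ _ => ?_
      have h1 := div_le_residualBound_sub hx (sub_nonneg.mpr (hgoal (b.set i γ)))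
      have h2 : ((x : ℝ) - ((goal - f (b.set i γ) : ℤ) : ℝ)) = gain f b i γ := by
        rw [hxdef, gain]; push_cast; ring
      rw [h2] at h1
      have := mul_le_mul_of_nonneg_right h1 (mass_nonneg hp (b.set i γ))
      calc _ = (gain f b i γ : ℝ) / x * mass p (b.set i γ) := by ring
        _ ≤ _ := this
        _ = _ := by ring
    -- Where `t'` costs at most (T + c i)/L it gains the whole distance `x` within that budget,
    -- while the greedy rate at `b` limits its expected gain there.
    have hopt : c i * partialExp p b (fun a => if O a ≤ (T + c i) / L then 1 else 0) ≤
        (T + c i) / L * (partialExp p b (fun a => (gain f b i (a i) : ℝ)) / x) := by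
      rcases hm0.eq_or_lt with hm | hm
      · simp [partialExp_eq_zero_of_mass hp hm.symm]
      have hgain : 0 ≤ expectedGain p f b i := by
        rw [expectedGain_eq_div]
        refine div_nonneg ?_ hm0
        have := partialExp_mono hp (b := b) (F := fun _ => 0)
          (G := fun a => (gain f b i (a i) : ℝ)) fun a _ => by
            exact_mod_cast sub_nonneg.mpr (hf b i (a i) hi.1)
        rwa [partialExp_const, zero_mul] at this
      have hb := partialExp_gain_within_budget_le hp hc hf hsub
        (r := expectedGain p f b i / c i) (div_nonneg hgain hci.le)
        (fun j hj => (div_le_iff₀ (hc j)).mp (hi.2 j hj)) t' (Extends.refl b)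
        (div_nonneg hTc hL.le : 0 ≤ (T + c i) / L)
      have hrew : partialExp p b (fun a => if t'.pathCost c a ≤ (T + c i) / L
          then (f (t'.finalState a b) : ℝ) - f b else 0) =
          x * partialExp p b (fun a => if O a ≤ (T + c i) / L then 1 else 0) := by
        rw [← partialExp_const_mul]
        refine partialExp_congr fun a _ => ?_
        rw [ht' a b, hxdef]
        split_ifs <;> simp
      rw [hrew] at hb
      rw [mass_mul_expectedGain f hm]
      have h3 := mul_le_mul_of_nonneg_left hb (div_nonneg hci.le hx'.le : 0 ≤ c i / x)
      calc _ = c i / x * (x * partialExp p b (fun a => if O a ≤ (T + c i) / L then 1 else 0)) := by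
            rw [← mul_assoc, div_mul_cancel₀ _ hx'.ne']
        _ ≤ _ := h3
        _ = _ := by field_simp
    -- If the cost of `t'` exceeds (T + c i)/L, neither minimum is truncated and their difference is
    -- exactly `c i`.
    have hmin : c i * mass p b ≤
        partialExp p b (fun a => min (T + c i) (L * O a) - min T (L * O a)) +
        c i * partialExp p b (fun a => if O a ≤ (T + c i) / L then 1 else 0) := by
      rw [← partialExp_const, ← partialExp_const_mul, ← partialExp_add]
      refine partialExp_mono hp fun a _ => ?_
      have h1 : min T (L * O a) ≤ min (T + c i) (L * O a) :=
        min_le_min_right _ (by linarith)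
      split_ifs with h2
      · linarith
      · rw [not_le, div_lt_iff₀ hL] at h2
        rw [min_eq_left (by linarith), min_eq_left (by linarith)]
        linarith
    have hsum := Finset.sum_le_sum fun γ (_ : γ ∈ Finset.univ) => ih γ hTc
    rw [Finset.sum_add_distrib, ← Finset.sum_div, Finset.sum_add_distrib, ← Finset.mul_sum] at hsum
    simp only [mul_assoc] at hsum
    rw [← Finset.mul_sum] at hsum
    rw [hcost, htrunc]
    set R := ∑ γ, residualBound (goal - f (b.set i γ)) * mass p (b.set i γ)
    set A := ∑ γ, partialExp p (b.set i γ) ((child γ).pathCost c)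
    set D := partialExp p b (fun a => (gain f b i (a i) : ℝ)) / x
    have h4 : (T + c i) / L * D ≤ (T + c i) / L * (residualBound x * mass p b - R) :=
      mul_le_mul_of_nonneg_left hres (div_nonneg hTc hL.le)
    have h5 : c i * (residualBound x * mass p b) / L ≤ c i * (H * mass p b) / L := by
      have := hH b
      gcongr
    -- One step of the summation by parts; the last bracket is nonnegative by `h5`.
    have h6 : (T * residualBound x * mass p b + H * (c i * mass p b + A)) / L =
        (T + c i) / L * (residualBound x * mass p b - R) + ((T + c i) * R + H * A) / L +
        (c i * (H * mass p b) / L - c i * (residualBound x * mass p b) / L) := by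
      field_simp
      ring
    rw [h6]
    linarith

/-- Adaptive Greedy is a logarithmic approximation for adaptive submodular cover. -/
theorem IsAdaptiveGreedy.expectedCost_le (hp : ∀ a, 0 ≤ p a) (hc : ∀ i, 0 < c i)
    (hf : MonotoneUtility f) (hsub : AdaptiveSubmodular p f) {goal : ℤ}
    (hpos : 0 < goal) (hnonneg : ∀ b, 0 ≤ f b) (hgoal : ∀ b, f b ≤ goal) {t' : DecisionTree n Γ}
    (ht' : ∀ a, f (t'.finalState a emptyPartial) = goal) {t : DecisionTree n Γ}
    (ht : IsAdaptiveGreedy p f goal c emptyPartial t) :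
    t.expectedCost p c ≤ 4 * (1 + Real.log goal) * t'.expectedCost p c := by
  set H := 1 + Real.log goal with hHdef
  have hH : 0 < H := by
    have : (1 : ℝ) ≤ goal := by exact_mod_cast hpos
    linarith [Real.log_nonneg this]
  -- `L = 2 * H` makes the final term half of the greedy cost; moving it to the left doubles `L` to
  -- `4 * H`.
  have key := ht.partialExp_pathCost_le (H := H) (L := 2 * H) (T := 0) hp hc hf hsub hgoal
    (fun a b => le_antisymm (hgoal _) ((ht' a).symm.le.trans
      (hf.le_of_extends (t'.finalState_extends_finalState a (extends_emptyPartial b)))))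
    (fun b => residualBound_le_of_le (sub_nonneg.mpr (hgoal b)) hpos (by linarith [hnonneg b]))
    (by linarith) le_rfl
  have hmin : partialExp p emptyPartial (fun a => min (0 + t.pathCost c a)
      (2 * H * t'.pathCost c a) - min 0 (2 * H * t'.pathCost c a)) ≤
      2 * H * partialExp p emptyPartial (t'.pathCost c) := by
    rw [← partialExp_const_mul]
    refine partialExp_mono hp fun a _ => ?_
    rw [min_eq_left (mul_nonneg (by linarith) (t'.pathCost_nonneg hc a)), sub_zero]
    exact min_le_right _ _
  have hhalf : (0 * residualBound (goal - f emptyPartial) * mass p emptyPartial +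
      H * partialExp p emptyPartial (t.pathCost c)) / (2 * H) =
      partialExp p emptyPartial (t.pathCost c) / 2 := by
    field_simp
    ring
  rw [hhalf] at key
  simp only [DecisionTree.expectedCost, ← partialExp_emptyPartial]
  linarith

end GreedyBound

/-! ### The combined utility of an instance -/

namespace Instance

variable (I : Instance n Γ)

lemma W_pos : 0 < I.W :=
  Finset.sum_pos I.weight_pos I.sample_nonempty

lemma sampleProb_nonneg (a : Realization n Γ) : 0 ≤ I.sampleProb a := by
  unfold sampleProb
  split_ifs
  · positivity
  · exact le_rfl

lemma g_le_of_extends {b b' : PartialRealization n Γ} (h : Extends b' b) : I.g b ≤ I.g b' :=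
  I.utility_monotone.le_of_extends h

lemma gW_eq_goal_iff (b : PartialRealization n Γ) :
    I.gW b = I.goal * I.W ↔ I.g b = I.goal ∨ I.hW b = I.W := by
  rw [gW, orConstruction, sub_eq_self, mul_eq_zero, sub_eq_zero, sub_eq_zero, eq_comm,
    eq_comm (a := (I.W : ℤ))]

lemma hW_le (b : PartialRealization n Γ) : I.hW b ≤ I.W := by
  classical
  unfold hW
  have : 0 ≤ ∑ a ∈ I.sample with Extends (Realization.toPartial a) b, (I.weight a : ℤ) :=
    Finset.sum_nonneg fun a _ => by positivity
  linarith

lemma hW_nonneg (b : PartialRealization n Γ) : 0 ≤ I.hW b := by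
  classical
  unfold hW W
  push_cast
  have := Finset.sum_le_sum_of_subset_of_nonneg (f := fun a => (I.weight a : ℤ))
    (Finset.filter_subset (fun a => Extends (Realization.toPartial a) b) I.sample)
    (fun a _ _ => by positivity)
  linarith

lemma hW_lt {a : Realization n Γ} (ha : a ∈ I.sample) {b : PartialRealization n Γ}
    (h : Extends (Realization.toPartial a) b) : I.hW b < I.W := by
  classical
  unfold hW
  have h1 := Finset.single_le_sum (f := fun a => (I.weight a : ℤ))
    (s := I.sample.filter fun a => Extends (Realization.toPartial a) b)
    (fun a _ => by positivity) (Finset.mem_filter.mpr ⟨ha, h⟩)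
  have h2 : (0 : ℤ) < I.weight a := by exact_mod_cast I.weight_pos a ha
  linarith

lemma hW_le_of_extends {b b' : PartialRealization n Γ} (h : Extends b' b) :
    I.hW b ≤ I.hW b' := by
  classical
  unfold hW
  refine sub_le_sub_left (Finset.sum_le_sum_of_subset_of_nonneg ?_ fun a _ _ => by positivity) _
  intro a ha
  simp only [Finset.mem_filter] at ha ⊢
  exact ⟨ha.1, ha.2.trans h⟩

/-- Every partial realization can be completed, by the states of some sample realization. -/
lemma g_le_goal (b : PartialRealization n Γ) : I.g b ≤ I.goal := by
  obtain ⟨a, -⟩ := I.sample_nonempty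
  have := I.g_le_of_extends (b := b)
    (b' := Realization.toPartial fun i => (b i).getD (a i)) fun i hi => by
      obtain ⟨γ, hγ⟩ := Option.ne_none_iff_exists'.mp hi
      simp [Realization.toPartial, hγ]
  exact this.trans (I.utility_goal _).le

lemma gW_le_goal (b : PartialRealization n Γ) : I.gW b ≤ I.goal * I.W :=
  sub_le_self _ (mul_nonneg (sub_nonneg.mpr (I.g_le_goal b)) (sub_nonneg.mpr (I.hW_le b)))

lemma gW_nonneg (b : PartialRealization n Γ) : 0 ≤ I.gW b := by
  have hg : 0 ≤ I.g b := Int.natCast_nonneg _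
  refine sub_nonneg.mpr (mul_le_mul (sub_le_self _ hg) (sub_le_self _ (I.hW_nonneg b))
    (sub_nonneg.mpr (I.hW_le b)) (by positivity))

lemma gW_monotone : MonotoneUtility I.gW := fun b i γ hi => by
  have h1 := I.g_le_of_extends (extends_set hi γ)
  have h2 := I.hW_le_of_extends (extends_set hi γ)
  refine sub_le_sub_left (mul_le_mul (by linarith) (by linarith)
    (sub_nonneg.mpr (I.hW_le _)) (sub_nonneg.mpr (I.g_le_goal b))) _

lemma exists_isCompletion (b : PartialRealization n Γ) :
    ∃ t : DecisionTree n Γ, IsCompletion I.g I.goal b t := by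
  induction hk : (unknown b).card using Nat.strong_induction_on generalizing b with
  | _ k ih =>
    by_cases hb : I.g b = I.goal
    · exact ⟨_, .done hb⟩
    obtain ⟨i, hi⟩ : ∃ i, b i = none := by
      by_contra! hall
      obtain ⟨a, rfl⟩ := exists_toPartial_eq hall
      exact hb (I.utility_goal a)
    choose child hchild using fun γ => ih _ (hk ▸ card_unknown_set_lt hi γ) (b.set i γ) rfl
    exact ⟨_, .choose hb hi hchild⟩

/-! ### Adaptive submodularity of the combined utility -/

section Fintype

variable [Fintype Γ]

lemma hW_eq_mass (b : PartialRealization n Γ) :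
    (I.hW b : ℝ) = I.W - I.W * mass I.sampleProb b := by
  classical
  have hW0 : (I.W : ℝ) ≠ 0 := by exact_mod_cast I.W_pos.ne'
  unfold hW mass partialExp sampleProb
  push_cast
  rw [Finset.mul_sum, Finset.sum_filter, Finset.sum_filter,
    ← Finset.sum_subset (Finset.subset_univ I.sample)]
  · congr 1
    refine Finset.sum_congr rfl fun a ha => ?_
    rw [if_pos ha]
    field_simp
  · intro a _ ha
    simp [ha]

lemma gW_eq_mass (b : PartialRealization n Γ) :
    (I.gW b : ℝ) = I.goal * I.W - I.W * ((I.goal - I.g b) * mass I.sampleProb b) := by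
  rw [gW, orConstruction]
  push_cast
  rw [hW_eq_mass]
  ring

/-- A form of the expected gain of the combined utility in which every factor is nonnegative and
does not increase as information is gained. -/
lemma expectedGain_gW {b : PartialRealization n Γ} {i : Fin n} (hi : b i = none)
    (hm : 0 < mass I.sampleProb b) :
    expectedGain I.sampleProb I.gW b i = I.W * ∑ γ,
      ((gain I.g b i γ : ℝ) * mass I.sampleProb (b.set i γ) +
        (I.goal - I.g (b.set i γ)) * (mass I.sampleProb (b.set i γ) -
          mass I.sampleProb (b.set i γ) ^ 2 / mass I.sampleProb b)) := by
  have hsplit := mass_eq_sum_set (p := I.sampleProb) hi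
  have h1 : ∀ γ, (gain I.gW b i γ : ℝ) * mass I.sampleProb (b.set i γ) =
      I.W * ((I.goal - I.g b) * mass I.sampleProb b * mass I.sampleProb (b.set i γ) -
        (I.goal - I.g (b.set i γ)) * mass I.sampleProb (b.set i γ) ^ 2) := fun γ => by
    rw [gain]
    push_cast
    rw [gW_eq_mass, gW_eq_mass]
    ring
  rw [expectedGain_eq_div, partialExp_apply_eq_sum hi (fun γ => (gain I.gW b i γ : ℝ)),
    Finset.sum_div, Finset.mul_sum]
  refine Finset.sum_congr rfl fun γ _ => ?_
  -- The form stated comes from writing Q − g(b) as the gain of g plus the distance remaining after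
  -- state γ.
  rw [h1, gain]
  push_cast
  field_simp
  ring

/-- With u = w − x the expression is xu/(x + u), which increases in both x and u. After clearing
denominators the difference is xx'(u − u') + uu'(x − x'). -/
lemma sub_sq_div_le_sub_sq_div {x x' w w' : ℝ} (hx' : 0 ≤ x') (hxx : x' ≤ x) (hw' : 0 < w')
    (hxw' : x' ≤ w') (h : x - x' ≤ w - w') : x' - x' ^ 2 / w' ≤ x - x ^ 2 / w := by
  have hw : 0 < w := by linarith
  have e : ∀ {y v : ℝ}, 0 < v → y - y ^ 2 / v = y * (v - y) / v := fun hv => by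
    field_simp
  rw [e hw, e hw', div_le_div_iff₀ hw' hw]
  have h1 : 0 ≤ w' - x' := by linarith
  have h2 := mul_nonneg (mul_nonneg (hx'.trans hxx) hx') (by linarith : 0 ≤ w - x - (w' - x'))
  have h3 := mul_nonneg (mul_nonneg (by linarith : 0 ≤ w - x) h1) (sub_nonneg.mpr hxx)
  linarith

/-- In the formula of `expectedGain_gW`, the terms are compared state by state and factor by factor,
using submodularity of g, its monotonicity, and `sub_sq_div_le_sub_sq_div` for the masses. -/
lemma adaptiveSubmodular_gW : AdaptiveSubmodular I.sampleProb I.gW := by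
  intro b b' i h hi' hm'
  have hp := I.sampleProb_nonneg
  have hi : b i = none := by
    by_contra hne
    exact hne (by rw [← h i hne, hi'])
  have hm := hm'.trans_le (mass_anti hp h)
  rw [I.expectedGain_gW hi hm, I.expectedGain_gW hi' hm']
  refine mul_le_mul_of_nonneg_left (Finset.sum_le_sum fun γ _ => ?_) (Nat.cast_nonneg _)
  have hset := mass_anti hp (h.set i γ)
  have hle' := mass_anti hp (extends_set hi' γ)
  -- Every branch loses nonnegative mass, so one branch loses at most the total; equivalently, the
  -- mass outside branch γ also shrinks.
  have hloss : mass I.sampleProb (b.set i γ) - mass I.sampleProb (b'.set i γ) ≤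
      mass I.sampleProb b - mass I.sampleProb b' := by
    rw [mass_eq_sum_set hi, mass_eq_sum_set hi', ← Finset.sum_sub_distrib]
    exact Finset.single_le_sum
      (f := fun γ => mass I.sampleProb (b.set i γ) - mass I.sampleProb (b'.set i γ))
      (fun γ _ => sub_nonneg.mpr (mass_anti hp (h.set i γ))) (Finset.mem_univ γ)
  have hgain : (gain I.g b' i γ : ℝ) ≤ gain I.g b i γ := by
    rcases eq_or_ne b' b with rfl | hne
    · exact le_rfl
    · exact_mod_cast I.utility_submodular b b' h hne i γ hi hi'
  have hgain0 : (0 : ℝ) ≤ gain I.g b i γ := by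
    exact_mod_cast sub_nonneg.mpr (I.g_le_of_extends (extends_set hi γ))
  have hg : (I.g (b.set i γ) : ℝ) ≤ I.g (b'.set i γ) := by
    exact_mod_cast I.g_le_of_extends (h.set i γ)
  have hgoal : (I.g (b.set i γ) : ℝ) ≤ I.goal := by
    exact_mod_cast I.g_le_goal (b.set i γ)
  have hm0 := mass_nonneg hp (b'.set i γ)
  refine add_le_add (mul_le_mul hgain hset hm0 hgain0) (mul_le_mul (by linarith)
    (sub_sq_div_le_sub_sq_div hm0 hset hm' hle' hloss) ?_ (by linarith))
  rw [sub_nonneg, div_le_iff₀ hm', sq]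
  exact mul_le_mul_of_nonneg_left hle' hm0

/-! ### Scenario Adaptive Greedy -/

lemma exists_isAdaptiveGreedy (b : PartialRealization n Γ) :
    ∃ t : DecisionTree n Γ, IsAdaptiveGreedy I.sampleProb I.gW (I.goal * I.W) I.cost b t := by
  induction hk : (unknown b).card using Nat.strong_induction_on generalizing b with
  | _ k ih =>
    by_cases hb : I.gW b = I.goal * I.W
    · exact ⟨_, .done hb⟩
    have hne : (unknown b).Nonempty := by
      by_contra hempty
      have hall : ∀ i, b i ≠ none := fun i hi =>
        hempty ⟨i, by simp [unknown, hi]⟩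
      obtain ⟨a, rfl⟩ := exists_toPartial_eq hall
      exact hb ((I.gW_eq_goal_iff _).mpr (Or.inl (I.utility_goal a)))
    obtain ⟨i, hi, hmax⟩ := Finset.exists_max_image (unknown b)
      (fun j => expectedGain I.sampleProb I.gW b j / I.cost j) hne
    have hi : b i = none := by simpa [unknown] using hi
    choose child hchild using fun γ => ih _ (hk ▸ card_unknown_set_lt hi γ) (b.set i γ) rfl
    exact ⟨_, .choose hb ⟨hi, fun j hj => hmax j (by simp [unknown, hj])⟩ hchild⟩

lemma exists_isScenarioAdaptiveGreedy : ∃ t : DecisionTree n Γ, I.IsScenarioAdaptiveGreedy t := by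
  obtain ⟨t₀, h₀⟩ := I.exists_isAdaptiveGreedy emptyPartial
  choose next hnext using I.exists_isCompletion
  exact ⟨_, t₀, next, h₀, hnext, rfl⟩

end Fintype

end Instance

/-! ### Feasibility and cost of the two-phase strategy -/

lemma ne_none_of_mem_insert {b : PartialRealization n Γ} {i : Fin n} {used : Finset (Fin n)}
    (hused : ∀ j ∈ used, b j ≠ none) (γ : Γ) : ∀ j ∈ insert i used, b.set i γ j ≠ none := by
  intro j hj
  by_cases hji : j = i
  · subst hji; simp [PartialRealization.set]
  · simpa [PartialRealization.set, hji] using hused j (Finset.mem_of_mem_insert_of_ne hj hji)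

lemma IsCompletion.noRepeat {f : PartialRealization n Γ → ℤ} {goal : ℤ}
    {b : PartialRealization n Γ} {t : DecisionTree n Γ} (ht : IsCompletion f goal b t)
    {used : Finset (Fin n)} (hused : ∀ j ∈ used, b j ≠ none) : t.NoRepeat used := by
  induction ht generalizing used with
  | done => trivial
  | choose _ hi _ ih =>
    exact ⟨fun h => hused _ h hi, fun γ => ih γ (ne_none_of_mem_insert hused γ)⟩

lemma IsCompletion.apply_finalState {f : PartialRealization n Γ → ℤ} {goal : ℤ}
    {b : PartialRealization n Γ} {t : DecisionTree n Γ} (ht : IsCompletion f goal b t)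
    (a : Realization n Γ) : f (t.finalState a b) = goal := by
  induction ht with
  | done h => exact h
  | choose _ _ _ ih => exact ih (a _)

lemma IsCompletion.eq_leaf {f : PartialRealization n Γ → ℤ} {goal : ℤ}
    {b : PartialRealization n Γ} {t : DecisionTree n Γ} (ht : IsCompletion f goal b t)
    (h : f b = goal) : t = .leaf := by
  cases ht with
  | done => rfl
  | choose hne => exact absurd h hne

section Fintype

variable [Fintype Γ]

/-- Both phases choose only unknown items, and used items stay known. -/
lemma IsAdaptiveGreedy.noRepeat_andThen {p : Realization n Γ → ℝ}
    {f : PartialRealization n Γ → ℤ} {goal : ℤ} {c : Fin n → ℝ} {b : PartialRealization n Γ}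
    {t : DecisionTree n Γ} (ht : IsAdaptiveGreedy p f goal c b t)
    {next : PartialRealization n Γ → DecisionTree n Γ} {f' : PartialRealization n Γ → ℤ}
    {goal' : ℤ} (hnext : ∀ b, IsCompletion f' goal' b (next b))
    {used : Finset (Fin n)} (hused : ∀ j ∈ used, b j ≠ none) :
    (t.andThen next b).NoRepeat used := by
  induction ht generalizing used with
  | @done b _ => exact (hnext b).noRepeat hused
  | choose _ hi _ ih =>
    exact ⟨fun h => hused _ h hi.1, fun γ => ih γ (ne_none_of_mem_insert hused γ)⟩

namespace Instance

variable (I : Instance n Γ)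

/-- On sample realizations, the goal is reached by the time that the greedy phase stops. -/
lemma pathCost_andThen {b : PartialRealization n Γ} {t : DecisionTree n Γ}
    (ht : IsAdaptiveGreedy I.sampleProb I.gW (I.goal * I.W) I.cost b t)
    {next : PartialRealization n Γ → DecisionTree n Γ}
    (hnext : ∀ b, IsCompletion I.g I.goal b (next b)) {a : Realization n Γ} (ha : a ∈ I.sample)
    (hab : Extends (Realization.toPartial a) b) :
    (t.andThen next b).pathCost I.cost a = t.pathCost I.cost a := by
  induction ht with
  | @done b h =>
    -- The consistent realization `a` has positive weight, so the stop cannot be due to all sample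
    -- weight being eliminated.
    have hg : I.g b = I.goal :=
      ((I.gW_eq_goal_iff b).mp h).resolve_right (I.hW_lt ha hab).ne
    simp only [DecisionTree.andThen, (hnext b).eq_leaf hg]
  | @choose b i child _ hi _ ih =>
    simp only [DecisionTree.andThen, DecisionTree.pathCost]
    rw [ih (a i) ((toPartial_extends_set_iff hi.1 _ a).mpr ⟨hab, rfl⟩)]

variable {I}

lemma IsScenarioAdaptiveGreedy.isFeasible {t : DecisionTree n Γ}
    (ht : I.IsScenarioAdaptiveGreedy t) : I.IsFeasible t := by
  obtain ⟨t₀, next, h₀, hnext, rfl⟩ := ht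
  refine ⟨h₀.noRepeat_andThen hnext (by simp), fun a => ?_⟩
  rw [DecisionTree.finalState_andThen]
  exact (hnext _).apply_finalState a

lemma IsScenarioAdaptiveGreedy.expectedCost_le {t t' : DecisionTree n Γ}
    (ht : I.IsScenarioAdaptiveGreedy t) (ht' : I.IsFeasible t') :
    I.expectedCost t ≤
      4 * (1 + Real.log ((I.goal : ℝ) * (I.W : ℝ))) * I.expectedCost t' := by
  obtain ⟨t₀, next, h₀, hnext, rfl⟩ := ht
  -- Outside the sample, where the completion may cost something, the probability is 0.
  have hcost : I.expectedCost (t₀.andThen next emptyPartial) = I.expectedCost t₀ := by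
    refine Finset.sum_congr rfl fun a _ => ?_
    by_cases ha : a ∈ I.sample
    · rw [I.pathCost_andThen h₀ hnext ha (extends_emptyPartial _)]
    · simp [sampleProb, ha]
  have hpos : (0 : ℤ) < I.goal * I.W :=
    mul_pos (by exact_mod_cast I.goal_pos) (by exact_mod_cast I.W_pos)
  have := h₀.expectedCost_le I.sampleProb_nonneg I.cost_pos I.gW_monotone
    I.adaptiveSubmodular_gW hpos I.gW_nonneg I.gW_le_goal
    (fun a => (I.gW_eq_goal_iff _).mpr (Or.inl (ht'.2 a)))
  rw [hcost]
  simpa [expectedCost] using this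

end Instance

end Fintype

end ScenarioSC

theorem theorem3 :
    ∃ C : ℝ, 0 < C ∧
      ∀ (n : ℕ) (Γ : Type u) [Fintype Γ] (I : ScenarioSC.Instance n Γ),
        (∃ t : ScenarioSC.DecisionTree n Γ, I.IsScenarioAdaptiveGreedy t) ∧
        ∀ t : ScenarioSC.DecisionTree n Γ, I.IsScenarioAdaptiveGreedy t →
          I.IsFeasible t ∧
          ∀ t' : ScenarioSC.DecisionTree n Γ, I.IsFeasible t' →
            I.expectedCost t ≤
              C * (1 + Real.log ((I.goal : ℝ) * (I.W : ℝ))) * I.expectedCost t' :=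
  ⟨4, by norm_num, fun _ _ _ I => ⟨I.exists_isScenarioAdaptiveGreedy, fun _ ht =>
    ⟨ht.isFeasible, fun _ ht' => ht.expectedCost_le ht'⟩⟩⟩
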